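/- **Theorem (Query Lower Bound).** For integers $0 \le k < n$ let $\Omega_{\mathrm{reflect}(k,n)}$ be the following oracle decision problem on $n$ qubits. The Yes-oracles are the unitaries $O_S = I - 2\Pi_S$, where $S \subseteq \mathbb{C}^{2^n}$ is any subspace with $1 \le \dim S \le 2^k$ and $\Pi_S$ is the orthogonal projector onto $S$. The only No-oracle is the identity $I$. An *$L$-query verifier* has an auxiliary register, consisting of the $n$-qubit oracle register $R_O$ and $a \ge 0$ further qubits, and an input register, which is a complex Hilbert space $W$ of arbitrary (possibly infinite) dimension, for example $W = (\mathbb{C}^2)^{\otimes n_{\mathrm{in}}}$. It is given by unitaries $U_0, \dots, U_L$ on the total space $\mathbb{C}^{2^n} \otimes \mathbb{C}^{2^a} \otimes W$ and orthogonal projectors $\Pi_1, \dots, \Pi_L$ on the space $\mathbb{C}^{2^a} \otimes W$ of everything but $R_O$. With oracle $O$ and a witness $\omega \in W$, $\|\omega\| = 1$, it prepares $U_L O^{\Pi_L} U_{L-1} \cdots U_1 O^{\Pi_1} U_0 (|0^{n+a}\rangle \otimes \omega)$, where $O^{\Pi} = I \otimes (I - \Pi) + O \otimes \Pi$ is the controlled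 query, measures the first auxiliary qubit (the first qubit of $R_O$) in the computational basis, and accepts if the outcome is $1$. It *uniquely solves* $\Omega_{\mathrm{reflect}(k,n)}$ with error $\varepsilon$ if * for every Yes-oracle there is a witness $\omega$ that is accepted with probability at least $1 - \varepsilon$ and such that every witness orthogonal to $\omega$ is accepted with probability at most $\varepsilon$; * for the No-oracle every witness is accepted with probability at most $\varepsilon$. Call $\varepsilon : \mathbb{N} \to \mathbb{R}$ exponentially small if $\varepsilon(n) = O(e^{-\alpha n})$ for some constant $\alpha > 0$. Then there is a constant $c > 0$ such that for every exponentially small $\varepsilon$ the following hold. 1. For all sufficiently large $n$ (depending on $\varepsilon$), all $k < n$, all $L$ and all $W$: every $L$-query verifier that uniquely solves $\Omega_{\mathrm{reflect}(k,n)}$ with error $\varepsilon(n)$ satisfies $L \ge c\sqrt{2^k}$. 2. In particular, if $k = k(n)$ satisfies $k(n) < n$ for all sufficiently large $n$ and $k(n) \in \Omega(n)$, then there is $b > 1$ such that for all sufficiently large $n$ every $L$-query verifier that uniquely solves $\Omega_{\mathrm{reflect}(k(n),n)}$ with error $\varepsilon(n)$, for any $L$ and any $W$, satisfies $L \ge b^n$.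 -/

import Mathlib

open Filter Asymptotics
open scoped TensorProduct

noncomputable section

/-- The Hilbert space `ℂ^(2^n)` of `n` qubits, with computational basis indexed by `{0,1}^n`. -/
abbrev Qubits (n : ℕ) : Type := EuclideanSpace ℂ (Fin n → Fin 2)

/-- The computational basis state `|x⟩`. -/
def ket {n : ℕ} (x : Fin n → Fin 2) : Qubits n := EuclideanSpace.single x 1

/-- A unitary on `n` qubits, used as an oracle. -/
abbrev Oracle (n : ℕ) : Type := Qubits n ≃ₗᵢ[ℂ] Qubits n

/-- An oracle decision problem: two disjoint sets of unitaries. -/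
structure OracleProblem (n : ℕ) where
  yes : Set (Oracle n)
  no : Set (Oracle n)
  disjoint : Disjoint yes no

/-- `O = I - 2 Π_S`, where `Π_S` is the orthogonal projector onto `S`. -/
def IsReflectionAbout {n : ℕ} (O : Oracle n) (S : Submodule ℂ (Qubits n)) : Prop :=
  ∀ v, O v = v - (2 : ℂ) • S.starProjection v

/-- Yes instances: the reflections `I - 2 Π_S` about the nonzero subspaces `S` of dimension at
most `2^k`. The only No instance is the identity. -/
def reflectProblem (k n : ℕ) : OracleProblem n where
  yes := {O | ∃ S : Submodule ℂ (Qubits n),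
    1 ≤ Module.finrank ℂ S ∧ Module.finrank ℂ S ≤ 2 ^ k ∧ IsReflectionAbout O S}
  no := {LinearIsometryEquiv.refl ℂ (Qubits n)}
  disjoint := by
    rw [Set.disjoint_singleton_right]
    rintro ⟨S, hS, -, hO⟩
    have hbot : S = ⊥ := by
      rw [Submodule.eq_bot_iff]
      intro v hv
      have h := hO v
      rw [Submodule.starProjection_eq_self_iff.mpr hv] at h
      have h2 : (2 : ℂ) • v = 0 := sub_eq_self.mp h.symm
      simpa using h2
    subst hbot
    simp at hS

/-- The projector `|1⟩⟨1|` on the first of `n` qubits, tensored with the identity on the others. -/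
def firstQubitOne (n : ℕ) : Qubits n →ₗ[ℂ] Qubits n :=
  Matrix.toEuclideanLin
    (Matrix.diagonal fun x => if ∃ i : Fin n, i.val = 0 ∧ x i = 1 then (1 : ℂ) else 0)

/-- The total space of a verifier. The auxiliary register consists of the `n`-qubit oracle
register followed by `a` further qubits; `W` is the Hilbert space of the input register. -/
abbrev VerifierSpace (n a : ℕ) (W : Type*) [NormedAddCommGroup W] [InnerProductSpace ℂ W] :
    Type _ :=
  Qubits n ⊗[ℂ] (Qubits a ⊗[ℂ] W)

/-- The controlled query `O^P = I ⊗ (I - P) + O ⊗ P`, where `P` is an operator on everything but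
the oracle register. -/
def controlledQuery {n : ℕ} {R : Type*} [NormedAddCommGroup R] [InnerProductSpace ℂ R]
    (O : Oracle n) (P : R →ₗ[ℂ] R) : (Qubits n ⊗[ℂ] R) →ₗ[ℂ] (Qubits n ⊗[ℂ] R) :=
  TensorProduct.map LinearMap.id (LinearMap.id - P) +
    TensorProduct.map O.toLinearEquiv.toLinearMap P

/-- An `L`-query oracle verifier with an `n`-qubit oracle register and input register `W`:
unitaries `U_0, …, U_L` on the total space, and projectors `Π_1, …, Π_L` onto the control
subspaces, which live on everything but the oracle register. The list `control` is indexed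
from zero. -/
structure OracleVerifier (n L : ℕ) (W : Type*) [NormedAddCommGroup W]
    [InnerProductSpace ℂ W] where
  /-- number of auxiliary qubits outside the oracle register -/
  a : ℕ
  U : Fin (L + 1) → (VerifierSpace n a W ≃ₗᵢ[ℂ] VerifierSpace n a W)
  control : Fin L → ((Qubits a ⊗[ℂ] W) →ₗ[ℂ] (Qubits a ⊗[ℂ] W))
  control_projector : ∀ i, (control i).IsSymmetricProjection

namespace OracleVerifier

variable {n L : ℕ} {W : Type*} [NormedAddCommGroup W] [InnerProductSpace ℂ W]

/-- The input state `|0…0⟩ ⊗ ω`. -/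
def init (V : OracleVerifier n L W) (ω : W) : VerifierSpace n V.a W :=
  ket (fun _ => 0) ⊗ₜ[ℂ] (ket (fun _ => 0) ⊗ₜ[ℂ] ω)

/-- The state `U_t O^{Π_t} U_{t-1} ⋯ U_1 O^{Π_1} U_0 (|0…0⟩ ⊗ ω)` after `t` queries. -/
def stateAfter (V : OracleVerifier n L W) (O : Oracle n) (ω : W) :
    (t : ℕ) → t ≤ L → VerifierSpace n V.a W
  | 0, _ => V.U 0 (V.init ω)
  | t + 1, h => V.U ⟨t + 1, Nat.succ_lt_succ h⟩
      (controlledQuery O (V.control ⟨t, h⟩) (V.stateAfter O ω t (Nat.le_of_succ_le h)))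

/-- The probability that the final measurement of the first auxiliary qubit gives `1`, on
witness `ω`. -/
def acceptProb (V : OracleVerifier n L W) (O : Oracle n) (ω : W) : ℝ :=
  ‖TensorProduct.map (firstQubitOne n) LinearMap.id (V.stateAfter O ω L le_rfl)‖ ^ 2

/-- `V` uniquely solves the oracle decision problem `Ω` with error `ε`. Witnesses are unit
vectors of the input register. -/
def UniquelySolves (V : OracleVerifier n L W) (Ω : OracleProblem n) (ε : ℝ) : Prop :=
  (∀ O ∈ Ω.yes, ∃ ω : W, ‖ω‖ = 1 ∧ 1 - ε ≤ V.acceptProb O ω ∧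
    ∀ ω' : W, ‖ω'‖ = 1 → inner ℂ ω ω' = 0 → V.acceptProb O ω' ≤ ε) ∧
  (∀ O ∈ Ω.no, ∀ ω : W, ‖ω‖ = 1 → V.acceptProb O ω ≤ ε)

end OracleVerifier

/-- `ε(n) = O(exp(-a n))` for some constant `a > 0`. -/
def ExponentiallySmall (ε : ℕ → ℝ) : Prop :=
  ∃ a : ℝ, 0 < a ∧ ε =O[atTop] fun n : ℕ => Real.exp (-a * n)

end

/-! For a basis state |x⟩ let ω_x be the unique witness for the reflection about its line. Adding
|y⟩ to the reflected subspace alters a run only through the amplitude with which its queries touch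
|y⟩ (a hybrid argument). Suppose ω_x hardly touches |y⟩ and ω_y hardly touches |x⟩. Then both stay
accepted under the reflection about span{|x⟩, |y⟩}, a Yes-oracle once k ≥ 1. Both are thus close to
its unique witness, hence to each other up to phase, so the reflection about |y⟩ accepts ω_x with
sizable amplitude. But the identity rejects ω_x, so ω_x must touch |y⟩ noticeably in the run with
the identity.

Hence every pair x ≠ y makes one of three weights large (`lt_queryWeight`). The squared weights of
one run sum to at most L², so counting all pairs gives L ≥ √(2^n)/500 for every k ≥ 1
(`mul_sqrt_two_pow_le`). For k = 0 the bound only needs L ≥ 1. A small constant error suffices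
throughout. -/

noncomputable section

/-! ### Symmetric projections and their tensor products. -/

namespace LinearMap

variable {E F : Type*} [NormedAddCommGroup E] [InnerProductSpace ℂ E]
  [NormedAddCommGroup F] [InnerProductSpace ℂ F]

theorem IsSymmetric.tensorMap {f : E →ₗ[ℂ] E} {g : F →ₗ[ℂ] F} (hf : f.IsSymmetric)
    (hg : g.IsSymmetric) : (TensorProduct.map f g).IsSymmetric := by
  intro u v
  induction u with
  | zero => simp
  | add u₁ u₂ h₁ h₂ => simp only [map_add, inner_add_left, h₁, h₂]
  | tmul a b =>
    induction v with
    | zero => simp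
    | add v₁ v₂ h₁ h₂ => simp only [map_add, inner_add_right, h₁, h₂]
    | tmul c d => simp [hf a c, hg b d]

theorem IsSymmetricProjection.tensorMap {f : E →ₗ[ℂ] E} {g : F →ₗ[ℂ] F}
    (hf : f.IsSymmetricProjection) (hg : g.IsSymmetricProjection) :
    (TensorProduct.map f g).IsSymmetricProjection where
  isIdempotentElem := by
    have hf' : f ∘ₗ f = f := hf.isIdempotentElem
    have hg' : g ∘ₗ g = g := hg.isIdempotentElem
    change TensorProduct.map f g ∘ₗ TensorProduct.map f g = _
    rw [← TensorProduct.map_comp, hf', hg']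
  isSymmetric := hf.isSymmetric.tensorMap hg.isSymmetric

theorem isSymmetricProjection_id : (LinearMap.id : E →ₗ[ℂ] E).IsSymmetricProjection where
  isIdempotentElem := rfl
  isSymmetric := LinearMap.IsSymmetric.id

theorem IsSymmetricProjection.inner_apply_self {p : E →ₗ[ℂ] E} (hp : p.IsSymmetricProjection)
    (v : E) : inner ℂ (p v) v = (‖p v‖ : ℂ) ^ 2 := by
  have h : p (p v) = p v := congrArg (· v) hp.isIdempotentElem
  have h2 := hp.isSymmetric (p v) v
  rw [h, inner_self_eq_norm_sq_to_K] at h2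
  exact h2

theorem IsSymmetricProjection.norm_apply_le {p : E →ₗ[ℂ] E} (hp : p.IsSymmetricProjection)
    (v : E) : ‖p v‖ ≤ ‖v‖ := by
  have h := norm_inner_le_norm (𝕜 := ℂ) (p v) v
  rw [hp.inner_apply_self, norm_pow, Complex.norm_real, norm_norm] at h
  nlinarith [norm_nonneg (p v), norm_nonneg v]

theorem IsSymmetricProjection.norm_sub_two_smul {p : E →ₗ[ℂ] E} (hp : p.IsSymmetricProjection)
    (v : E) : ‖v - (2 : ℂ) • p v‖ = ‖v‖ := by
  have h := norm_sub_sq (𝕜 := ℂ) v ((2 : ℂ) • p v)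
  rw [inner_smul_right, ← hp.isSymmetric, hp.inner_apply_self, norm_smul] at h
  have h2 : (RCLike.re ((2 : ℂ) * (‖p v‖ : ℂ) ^ 2)) = 2 * ‖p v‖ ^ 2 := by
    rw [← Complex.ofReal_pow]; simp [-Complex.ofReal_pow]
  rw [h2] at h
  have h3 : ‖(2 : ℂ)‖ = 2 := by simp
  rw [h3] at h
  refine (sq_eq_sq₀ (norm_nonneg _) (norm_nonneg _)).mp ?_
  linarith

end LinearMap

/-! ### Basis-state projectors and controlled queries. -/

/-- The projector onto the computational basis state `|y⟩`. -/
def ketProj {n : ℕ} (y : Fin n → Fin 2) : Qubits n →ₗ[ℂ] Qubits n :=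
  (InnerProductSpace.rankOne ℂ (ket y) (ket y)).toLinearMap

@[simp] theorem norm_ket {n : ℕ} (y : Fin n → Fin 2) : ‖ket y‖ = 1 := by simp [ket]

theorem ketProj_apply {n : ℕ} (y : Fin n → Fin 2) (v : Qubits n) :
    ketProj y v = inner ℂ (ket y) v • ket y := rfl

theorem isSymmetricProjection_ketProj {n : ℕ} (y : Fin n → Fin 2) :
    (ketProj y).IsSymmetricProjection :=
  InnerProductSpace.isSymmetricProjection_rankOne_self (norm_ket y)

theorem sum_ketProj (n : ℕ) : ∑ y, ketProj y = (LinearMap.id : Qubits n →ₗ[ℂ] Qubits n) := by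
  ext1 v
  rw [LinearMap.sum_apply]
  have h := (EuclideanSpace.basisFun (Fin n → Fin 2) ℂ).sum_repr' v
  simpa [ketProj_apply, ket] using h

theorem isSymmetricProjection_firstQubitOne (n : ℕ) :
    (firstQubitOne n).IsSymmetricProjection where
  isIdempotentElem := by
    change firstQubitOne n ∘ₗ firstQubitOne n = firstQubitOne n
    ext v x
    simp +contextual [firstQubitOne, Matrix.mulVec_diagonal]
  isSymmetric := by
    rw [firstQubitOne, Matrix.isSymmetric_toEuclideanLin_iff]
    refine Matrix.isHermitian_diagonal_of_self_adjoint _ ?_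
    ext x
    simp only [Pi.star_apply]
    split_ifs <;> simp

section Query

variable {n : ℕ} {R : Type*} [NormedAddCommGroup R] [InnerProductSpace ℂ R]

/-- The projections `ketProj y ⊗ P` add up to `id ⊗ P`, and ‖p v‖² = ⟨p v, v⟩ is linear in the
projection p. -/
theorem sum_norm_sq_ketProj_le {P : R →ₗ[ℂ] R} (hP : P.IsSymmetricProjection)
    (v : Qubits n ⊗[ℂ] R) : ∑ y, ‖TensorProduct.map (ketProj y) P v‖ ^ 2 ≤ ‖v‖ ^ 2 := by
  have hid := LinearMap.isSymmetricProjection_id.tensorMap (E := Qubits n) hP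
  have h : (∑ y, (‖TensorProduct.map (ketProj y) P v‖ : ℂ) ^ 2) =
      (‖TensorProduct.map (LinearMap.id : Qubits n →ₗ[ℂ] Qubits n) P v‖ : ℂ) ^ 2 := by
    rw [← hid.inner_apply_self, ← sum_ketProj, ← TensorProduct.mapBilinear_apply, map_sum,
      LinearMap.sum_apply, LinearMap.sum_apply, sum_inner]
    refine Finset.sum_congr rfl fun y _ => ?_
    rw [← ((isSymmetricProjection_ketProj y).tensorMap hP).inner_apply_self]
    rfl
  have h' : ∑ y, ‖TensorProduct.map (ketProj y) P v‖ ^ 2 =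
      ‖TensorProduct.map (LinearMap.id : Qubits n →ₗ[ℂ] Qubits n) P v‖ ^ 2 := by exact_mod_cast h
  rw [h']
  gcongr
  exact hid.norm_apply_le v

theorem controlledQuery_eq_sub {O O' : Oracle n} {p : Qubits n →ₗ[ℂ] Qubits n}
    (h : ∀ v, O' v = O v - (2 : ℂ) • p v) (P : R →ₗ[ℂ] R) (v : Qubits n ⊗[ℂ] R) :
    controlledQuery O' P v = controlledQuery O P v - (2 : ℂ) • TensorProduct.map p P v := by
  have h' : O.toLinearEquiv.toLinearMap = O'.toLinearEquiv.toLinearMap + (2 : ℂ) • p :=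
    LinearMap.ext fun v => (by simp [h] : O v = O' v + (2 : ℂ) • p v)
  rw [eq_sub_iff_add_eq]
  simp only [controlledQuery, h', LinearMap.add_apply, TensorProduct.map_add_left,
    TensorProduct.map_smul_left, LinearMap.smul_apply, add_assoc]

theorem controlledQuery_refl (P : R →ₗ[ℂ] R) (v : Qubits n ⊗[ℂ] R) :
    controlledQuery (LinearIsometryEquiv.refl ℂ (Qubits n)) P v = v := by
  change (TensorProduct.map LinearMap.id (LinearMap.id - P) +
    TensorProduct.map LinearMap.id P : (Qubits n ⊗[ℂ] R) →ₗ[ℂ] Qubits n ⊗[ℂ] R) v = v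
  rw [← TensorProduct.map_add_right, sub_add_cancel, TensorProduct.map_id, LinearMap.id_apply]

/-- A controlled reflection is itself a reflection, I - 2 (Π_S ⊗ P). -/
theorem norm_controlledQuery {O : Oracle n} {S : Submodule ℂ (Qubits n)}
    (hO : IsReflectionAbout O S) {P : R →ₗ[ℂ] R} (hP : P.IsSymmetricProjection)
    (v : Qubits n ⊗[ℂ] R) : ‖controlledQuery O P v‖ = ‖v‖ := by
  rw [controlledQuery_eq_sub (O := LinearIsometryEquiv.refl ℂ (Qubits n))
    (p := S.starProjection.toLinearMap) hO, controlledQuery_refl]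
  exact ((Submodule.isSymmetricProjection_starProjection S).tensorMap hP).norm_sub_two_smul v

end Query

/-! ### Query circuits and the hybrid argument. -/

/-- A sequence of unitaries interleaved with controlled queries, on an arbitrary register beside
the oracle register. -/
structure QueryCircuit (n L : ℕ) (R : Type*) [NormedAddCommGroup R] [InnerProductSpace ℂ R] where
  U : Fin (L + 1) → ((Qubits n ⊗[ℂ] R) ≃ₗᵢ[ℂ] (Qubits n ⊗[ℂ] R))
  control : Fin L → (R →ₗ[ℂ] R)
  control_projector : ∀ i, (control i).IsSymmetricProjection

namespace QueryCircuit

variable {n L : ℕ} {R : Type*} [NormedAddCommGroup R] [InnerProductSpace ℂ R]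

/-- The state after `t` queries, starting from `v`, as a linear function of `v`. -/
def state (C : QueryCircuit n L R) (O : Oracle n) :
    (t : ℕ) → t ≤ L → (Qubits n ⊗[ℂ] R) →ₗ[ℂ] (Qubits n ⊗[ℂ] R)
  | 0, _ => (C.U 0).toLinearEquiv.toLinearMap
  | t + 1, h => (C.U ⟨t + 1, Nat.succ_lt_succ h⟩).toLinearEquiv.toLinearMap ∘ₗ
      controlledQuery O (C.control ⟨t, h⟩) ∘ₗ C.state O t (Nat.le_of_succ_le h)

theorem norm_state (C : QueryCircuit n L R) {O : Oracle n}
    {S : Submodule ℂ (Qubits n)} (hO : IsReflectionAbout O S) (v : Qubits n ⊗[ℂ] R) (t : ℕ)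
    (h : t ≤ L) : ‖C.state O t h v‖ = ‖v‖ := by
  induction t with
  | zero => exact (C.U 0).norm_map v
  | succ t ih =>
    refine ((C.U _).norm_map _).trans ?_
    rw [LinearMap.comp_apply, norm_controlledQuery hO (C.control_projector _), ih]

/-- The total amplitude with which the queries to `O`, starting from `v`, touch `|y⟩`. -/
def queryWeight (C : QueryCircuit n L R) (O : Oracle n) (v : Qubits n ⊗[ℂ] R)
    (y : Fin n → Fin 2) : ℝ :=
  ∑ i : Fin L, ‖TensorProduct.map (ketProj y) (C.control i) (C.state O i i.2.le v)‖

theorem queryWeight_nonneg (C : QueryCircuit n L R) (O : Oracle n) (v : Qubits n ⊗[ℂ] R)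
    (y : Fin n → Fin 2) : 0 ≤ C.queryWeight O v y :=
  Finset.sum_nonneg fun _ _ => norm_nonneg _

/-- Cauchy–Schwarz over the L queries costs a factor L, and each query contributes at most 1 in
total over all y. -/
theorem sum_queryWeight_sq_le (C : QueryCircuit n L R) {O : Oracle n}
    {S : Submodule ℂ (Qubits n)} (hO : IsReflectionAbout O S) {v : Qubits n ⊗[ℂ] R}
    (hv : ‖v‖ = 1) : ∑ y, C.queryWeight O v y ^ 2 ≤ (L : ℝ) ^ 2 := by
  calc ∑ y, C.queryWeight O v y ^ 2
      ≤ ∑ y, (L : ℝ) * ∑ i : Fin L,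
          ‖TensorProduct.map (ketProj y) (C.control i) (C.state O i i.2.le v)‖ ^ 2 := by
        refine Finset.sum_le_sum fun y _ => ?_
        have h := sq_sum_le_card_mul_sum_sq (s := Finset.univ) (f := fun i : Fin L =>
          ‖TensorProduct.map (ketProj y) (C.control i) (C.state O i i.2.le v)‖)
        simpa [queryWeight] using h
    _ = (L : ℝ) * ∑ i : Fin L, ∑ y,
          ‖TensorProduct.map (ketProj y) (C.control i) (C.state O i i.2.le v)‖ ^ 2 := by
        rw [← Finset.mul_sum, Finset.sum_comm]
    _ ≤ (L : ℝ) * ∑ i : Fin L, (1 : ℝ) := by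
        gcongr with i
        refine (sum_norm_sq_ketProj_le (C.control_projector i) _).trans ?_
        rw [C.norm_state hO, hv, one_pow]
    _ = (L : ℝ) ^ 2 := by simp [sq]

theorem norm_state_sub_le (C : QueryCircuit n L R) {O O' : Oracle n}
    {S' : Submodule ℂ (Qubits n)} (hO' : IsReflectionAbout O' S') {y : Fin n → Fin 2}
    (hy : ∀ u, O' u = O u - (2 : ℂ) • ketProj y u) (v : Qubits n ⊗[ℂ] R) (t : ℕ) (h : t ≤ L) :
    ‖C.state O' t h v - C.state O t h v‖ ≤
      2 * ∑ i : Fin t, ‖TensorProduct.map (ketProj y) (C.control (Fin.castLE h i))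
        (C.state O i (i.2.le.trans h) v)‖ := by
  induction t with
  | zero => simp [state]
  | succ t ih =>
    have ht := Nat.le_of_succ_le h
    rw [Fin.sum_univ_castSucc, mul_add]
    set s := C.state O t ht v with hs
    set s' := C.state O' t ht v with hs'
    set P := C.control ⟨t, h⟩ with hP
    -- The old error is propagated by `O'`, which preserves its norm; the new error is evaluated on
    -- the state under `O`. Thus only weights of the run with `O` enter the bound.
    have e : controlledQuery O' P s' - controlledQuery O P s =
        controlledQuery O' P (s' - s) - (2 : ℂ) • TensorProduct.map (ketProj y) P s := by
      rw [map_sub, controlledQuery_eq_sub hy P s]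
      abel
    have e' : C.state O' (t + 1) h v - C.state O (t + 1) h v = C.U ⟨t + 1, Nat.succ_lt_succ h⟩
        (controlledQuery O' P (s' - s) - (2 : ℂ) • TensorProduct.map (ketProj y) P s) := by
      rw [← e, map_sub]
      rfl
    rw [e', LinearIsometryEquiv.norm_map]
    refine (norm_sub_le _ _).trans (add_le_add ?_ ?_)
    · rw [norm_controlledQuery hO' (C.control_projector _)]
      exact ih ht
    · rw [norm_smul, Complex.norm_ofNat]
      rfl

/-- The norm of the accepted part of the final state. -/
def acceptAmp (C : QueryCircuit n L R) (O : Oracle n) (v : Qubits n ⊗[ℂ] R) : ℝ :=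
  ‖TensorProduct.map (firstQubitOne n) LinearMap.id (C.state O L le_rfl v)‖

theorem acceptAmp_add_le (C : QueryCircuit n L R) (O : Oracle n) (v w : Qubits n ⊗[ℂ] R) :
    C.acceptAmp O (v + w) ≤ C.acceptAmp O v + C.acceptAmp O w := by
  rw [acceptAmp, map_add, map_add]
  exact norm_add_le _ _

theorem acceptAmp_smul (C : QueryCircuit n L R) (O : Oracle n) (c : ℂ) (v : Qubits n ⊗[ℂ] R) :
    C.acceptAmp O (c • v) = ‖c‖ * C.acceptAmp O v := by
  rw [acceptAmp, map_smul, map_smul, norm_smul, acceptAmp]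

theorem acceptAmp_le_norm (C : QueryCircuit n L R) {O : Oracle n}
    {S : Submodule ℂ (Qubits n)} (hO : IsReflectionAbout O S) (v : Qubits n ⊗[ℂ] R) :
    C.acceptAmp O v ≤ ‖v‖ := by
  rw [← C.norm_state hO v L le_rfl]
  exact ((isSymmetricProjection_firstQubitOne n).tensorMap
    LinearMap.isSymmetricProjection_id).norm_apply_le _

theorem abs_acceptAmp_sub_le (C : QueryCircuit n L R) {O O' : Oracle n}
    {S' : Submodule ℂ (Qubits n)} (hO' : IsReflectionAbout O' S') {y : Fin n → Fin 2}
    (hy : ∀ u, O' u = O u - (2 : ℂ) • ketProj y u) (v : Qubits n ⊗[ℂ] R) :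
    |C.acceptAmp O' v - C.acceptAmp O v| ≤ 2 * C.queryWeight O v y := by
  refine (abs_norm_sub_norm_le _ _).trans ?_
  rw [← map_sub]
  refine (((isSymmetricProjection_firstQubitOne n).tensorMap
    LinearMap.isSymmetricProjection_id).norm_apply_le _).trans ?_
  exact C.norm_state_sub_le hO' hy v L le_rfl

end QueryCircuit

/-! ### Acceptance amplitudes of verifiers. -/

namespace OracleVerifier

variable {n L : ℕ} {W : Type*} [NormedAddCommGroup W] [InnerProductSpace ℂ W]

/-- The circuit of a verifier, forgetting the structure of the register beside `R_O`. -/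
def circuit (V : OracleVerifier n L W) : QueryCircuit n L (Qubits V.a ⊗[ℂ] W) where
  U := V.U
  control := V.control
  control_projector := V.control_projector

theorem stateAfter_eq (V : OracleVerifier n L W) (O : Oracle n) (ω : W) (t : ℕ) (h : t ≤ L) :
    V.stateAfter O ω t h = V.circuit.state O t h (V.init ω) := by
  induction t with
  | zero => rfl
  | succ t ih =>
    rw [stateAfter, ih]
    rfl

theorem norm_init (V : OracleVerifier n L W) (ω : W) : ‖V.init ω‖ = ‖ω‖ := by
  simp [init]

/-- The norm of the accepted part of the final state on witness `ω`. -/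
def acceptAmp (V : OracleVerifier n L W) (O : Oracle n) (ω : W) : ℝ :=
  V.circuit.acceptAmp O (V.init ω)

theorem acceptAmp_nonneg (V : OracleVerifier n L W) (O : Oracle n) (ω : W) :
    0 ≤ V.acceptAmp O ω := norm_nonneg _

theorem acceptProb_eq (V : OracleVerifier n L W) (O : Oracle n) (ω : W) :
    V.acceptProb O ω = V.acceptAmp O ω ^ 2 := by
  rw [acceptProb, stateAfter_eq]
  rfl

theorem acceptAmp_add_le (V : OracleVerifier n L W) (O : Oracle n) (ω ω' : W) :
    V.acceptAmp O (ω + ω') ≤ V.acceptAmp O ω + V.acceptAmp O ω' := by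
  have h : V.init (ω + ω') = V.init ω + V.init ω' := by simp [init, TensorProduct.tmul_add]
  rw [acceptAmp, h]
  exact V.circuit.acceptAmp_add_le O _ _

theorem acceptAmp_smul (V : OracleVerifier n L W) (O : Oracle n) (c : ℂ) (ω : W) :
    V.acceptAmp O (c • ω) = ‖c‖ * V.acceptAmp O ω := by
  have h : V.init (c • ω) = c • V.init ω := by simp [init, TensorProduct.tmul_smul]
  rw [acceptAmp, h]
  exact V.circuit.acceptAmp_smul O _ _

theorem acceptAmp_le_norm (V : OracleVerifier n L W) {O : Oracle n}
    {S : Submodule ℂ (Qubits n)} (hO : IsReflectionAbout O S) (ω : W) :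
    V.acceptAmp O ω ≤ ‖ω‖ :=
  (V.circuit.acceptAmp_le_norm hO _).trans_eq (V.norm_init ω)

/-- The total amplitude with which the queries of `V` to `O`, on witness `ω`, touch `|y⟩`. -/
def queryWeight (V : OracleVerifier n L W) (O : Oracle n) (ω : W) (y : Fin n → Fin 2) : ℝ :=
  V.circuit.queryWeight O (V.init ω) y

theorem sum_queryWeight_sq_le (V : OracleVerifier n L W) {O : Oracle n}
    {S : Submodule ℂ (Qubits n)} (hO : IsReflectionAbout O S) {ω : W} (hω : ‖ω‖ = 1) :
    ∑ y, V.queryWeight O ω y ^ 2 ≤ (L : ℝ) ^ 2 :=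
  V.circuit.sum_queryWeight_sq_le hO ((V.norm_init ω).trans hω)

theorem abs_acceptAmp_sub_le (V : OracleVerifier n L W) {O O' : Oracle n}
    {S' : Submodule ℂ (Qubits n)} (hO' : IsReflectionAbout O' S') {y : Fin n → Fin 2}
    (hy : ∀ v, O' v = O v - (2 : ℂ) • ketProj y v) (ω : W) :
    |V.acceptAmp O' ω - V.acceptAmp O ω| ≤ 2 * V.queryWeight O ω y :=
  V.circuit.abs_acceptAmp_sub_le hO' hy _

/-- Every witness orthogonal to `ω` has acceptance amplitude at most `δ`. -/
def RejectsOrthogonal (V : OracleVerifier n L W) (O : Oracle n) (ω : W) (δ : ℝ) : Prop :=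
  ∀ ω' : W, inner ℂ ω ω' = 0 → V.acceptAmp O ω' ≤ δ * ‖ω'‖

theorem rejectsOrthogonal_of_acceptProb_le (V : OracleVerifier n L W) {O : Oracle n} {ω : W}
    {δ : ℝ} (hδ : 0 ≤ δ)
    (h : ∀ ω' : W, ‖ω'‖ = 1 → inner ℂ ω ω' = 0 → V.acceptProb O ω' ≤ δ ^ 2) :
    V.RejectsOrthogonal O ω δ := by
  intro ω' horth
  rcases eq_or_ne ω' 0 with rfl | h0
  · have := V.acceptAmp_smul O 0 0
    simp_all
  · have hn : 0 < ‖ω'‖ := norm_pos_iff.mpr h0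
    have key := h ((‖ω'‖⁻¹ : ℂ) • ω') (by simp [norm_smul, hn.ne'])
      (by rw [inner_smul_right, horth, mul_zero])
    rw [acceptProb_eq, sq_le_sq₀ (V.acceptAmp_nonneg _ _) hδ, acceptAmp_smul] at key
    simp only [norm_inv, Complex.norm_real, norm_norm] at key
    rwa [inv_mul_le_iff₀ hn, mul_comm] at key

/-- The amplitude is a seminorm in the witness: split `ω'` into its component along `ω` and an
orthogonal rest, which contributes at most δ times its norm. -/
theorem acceptAmp_bounds (V : OracleVerifier n L W) {O : Oracle n} {ω : W} {δ : ℝ}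
    (hω : ‖ω‖ = 1) (h : V.RejectsOrthogonal O ω δ) (ω' : W) :
    ‖inner ℂ ω ω'‖ * V.acceptAmp O ω ≤ V.acceptAmp O ω' + δ * ‖ω' - inner ℂ ω ω' • ω‖ ∧
    V.acceptAmp O ω' ≤ ‖inner ℂ ω ω'‖ * V.acceptAmp O ω + δ * ‖ω' - inner ℂ ω ω' • ω‖ := by
  have horth : inner ℂ ω (ω' - inner ℂ ω ω' • ω) = 0 := by
    rw [inner_sub_right, inner_smul_right, inner_self_eq_norm_sq_to_K, hω]; simp
  have hr := h _ horth
  rw [← acceptAmp_smul]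
  constructor
  · have h1 := V.acceptAmp_add_le O ω' ((-1 : ℂ) • (ω' - inner ℂ ω ω' • ω))
    rw [acceptAmp_smul, norm_neg, norm_one, one_mul, neg_one_smul, ← sub_eq_add_neg,
      sub_sub_cancel] at h1
    linarith
  · have h1 := V.acceptAmp_add_le O (inner ℂ ω ω' • ω) (ω' - inner ℂ ω ω' • ω)
    rw [add_sub_cancel] at h1
    linarith

end OracleVerifier

/-! ### Geometry of nearly parallel unit vectors. -/

section Inner

variable {E : Type*} [NormedAddCommGroup E] [InnerProductSpace ℂ E]

theorem norm_sub_inner_smul_sq {z : E} (hz : ‖z‖ = 1) (v : E) :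
    ‖v - inner ℂ z v • z‖ ^ 2 = ‖v‖ ^ 2 - ‖inner ℂ z v‖ ^ 2 := by
  have h := norm_sub_sq (𝕜 := ℂ) v (inner ℂ z v • z)
  rw [inner_smul_right, inner_mul_symm_re_eq_norm, norm_mul, norm_inner_symm v z, norm_smul,
    hz] at h
  rw [h]
  ring

/-- Two unit vectors that are close to the line of a third one are close to each other. -/
theorem two_mul_sq_sub_one_le_norm_inner {z v w : E} (hz : ‖z‖ = 1) (hv : ‖v‖ = 1)
    (hw : ‖w‖ = 1) {p : ℝ} (hp : 0 ≤ p) (hpv : p ≤ ‖inner ℂ z v‖) (hpw : p ≤ ‖inner ℂ z w‖) :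
    2 * p ^ 2 - 1 ≤ ‖inner ℂ v w‖ := by
  have h1 := norm_sub_inner_smul_sq hz v
  have h2 := norm_sub_inner_smul_sq hz w
  -- The components along `z` contribute at least p² in modulus; those orthogonal to `z` cancel at
  -- most 1 - p².
  have e : inner ℂ (v - inner ℂ z v • z) (w - inner ℂ z w • z) =
      inner ℂ v w - inner ℂ v z * inner ℂ z w := by
    rw [inner_sub_left, inner_sub_right, inner_sub_right, inner_smul_left, inner_smul_left,
      inner_smul_right, inner_smul_right, inner_self_eq_norm_sq_to_K, hz, inner_conj_symm]
    push_cast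
    ring
  have h3 := norm_inner_le_norm (𝕜 := ℂ) (v - inner ℂ z v • z) (w - inner ℂ z w • z)
  rw [e] at h3
  have h4 := norm_sub_norm_le (inner ℂ v z * inner ℂ z w) (inner ℂ v w)
  rw [norm_sub_rev, norm_mul, norm_inner_symm v z] at h4
  rw [hv] at h1
  rw [hw] at h2
  set r := ‖v - inner ℂ z v • z‖
  set s := ‖w - inner ℂ z w • z‖
  have hrs : r * s ≤ 1 - p ^ 2 := by nlinarith [sq_nonneg (r - s)]
  nlinarith [mul_le_mul hpv hpw hp (norm_nonneg _)]

end Inner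

/-! ### Reflections about spans of basis states. -/

/-- The oracle `I - 2 Π_S`. -/
def reflectOracle {n : ℕ} (S : Submodule ℂ (Qubits n)) : Oracle n := Sᗮ.reflection

theorem isReflectionAbout_reflectOracle {n : ℕ} (S : Submodule ℂ (Qubits n)) :
    IsReflectionAbout (reflectOracle S) S := by
  intro v
  rw [reflectOracle, Submodule.reflection_apply, Submodule.starProjection_orthogonal_val,
    two_smul, two_smul]
  abel

theorem reflectOracle_bot (n : ℕ) :
    reflectOracle (⊥ : Submodule ℂ (Qubits n)) = LinearIsometryEquiv.refl ℂ (Qubits n) := by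
  ext1 v
  rw [isReflectionAbout_reflectOracle]
  simp

/-- The line spanned by a computational basis state. -/
def ketLine {n : ℕ} (y : Fin n → Fin 2) : Submodule ℂ (Qubits n) := ℂ ∙ ket y

theorem ketLine_isOrtho {n : ℕ} {x y : Fin n → Fin 2} (h : x ≠ y) : ketLine x ⟂ ketLine y := by
  rw [ketLine, ketLine, Submodule.isOrtho_span]
  rintro _ rfl _ rfl
  simp [ket, EuclideanSpace.inner_single_left, h]

theorem finrank_ketLine {n : ℕ} (y : Fin n → Fin 2) : Module.finrank ℂ (ketLine y) = 1 :=
  finrank_span_singleton (norm_ne_zero_iff.mp (by simp))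

theorem starProjection_ketLine {n : ℕ} (y : Fin n → Fin 2) (v : Qubits n) :
    (ketLine y).starProjection v = ketProj y v :=
  Submodule.starProjection_unit_singleton ℂ (norm_ket y) v

/-- Projectors onto orthogonal subspaces add, so the two oracles differ by the rank-one term that
the hybrid argument requires. -/
theorem reflectOracle_sup_ketLine {n : ℕ} {S : Submodule ℂ (Qubits n)} {y : Fin n → Fin 2}
    (h : S ⟂ ketLine y) (v : Qubits n) :
    reflectOracle (S ⊔ ketLine y) v = reflectOracle S v - (2 : ℂ) • ketProj y v := by
  have key : (S ⊔ ketLine y).starProjection v = S.starProjection v + ketProj y v := by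
    rw [← starProjection_ketLine]
    refine Submodule.eq_starProjection_of_mem_orthogonal
      (Submodule.add_mem_sup (Submodule.starProjection_apply_mem _ _)
        (Submodule.starProjection_apply_mem _ _)) ?_
    rw [← Submodule.inf_orthogonal]
    refine ⟨?_, ?_⟩
    · rw [← sub_sub]
      exact Sᗮ.sub_mem (Submodule.sub_starProjection_mem_orthogonal v)
        (h.symm.le (Submodule.starProjection_apply_mem _ _))
    · rw [add_comm, ← sub_sub]
      exact (ketLine y)ᗮ.sub_mem (Submodule.sub_starProjection_mem_orthogonal v)
        (h.le (Submodule.starProjection_apply_mem _ _))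
  rw [isReflectionAbout_reflectOracle, isReflectionAbout_reflectOracle, key, smul_add, sub_sub]

/-! ### The query lower bound at constant error. -/

namespace OracleVerifier

variable {n L : ℕ} {W : Type*} [NormedAddCommGroup W] [InnerProductSpace ℂ W]

theorem abs_acceptAmp_sup_sub_le (V : OracleVerifier n L W) {S : Submodule ℂ (Qubits n)}
    {y : Fin n → Fin 2} (h : S ⟂ ketLine y) (ω : W) :
    |V.acceptAmp (reflectOracle (S ⊔ ketLine y)) ω - V.acceptAmp (reflectOracle S) ω| ≤
      2 * V.queryWeight (reflectOracle S) ω y :=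
  V.abs_acceptAmp_sub_le (isReflectionAbout_reflectOracle _) (reflectOracle_sup_ketLine h) ω

/-- A witness that is accepted with amplitude near `1` is close to the unique witness. -/
theorem le_norm_inner_of_le_acceptAmp (V : OracleVerifier n L W) {S : Submodule ℂ (Qubits n)}
    {z ω : W} {δ : ℝ} (hδ : 0 ≤ δ) (hz : ‖z‖ = 1) (hω : ‖ω‖ = 1)
    (h : V.RejectsOrthogonal (reflectOracle S) z δ) :
    V.acceptAmp (reflectOracle S) ω - δ ≤ ‖inner ℂ z ω‖ := by
  have h1 := (V.acceptAmp_bounds hz h ω).2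
  have h2 := V.acceptAmp_le_norm (isReflectionAbout_reflectOracle S) z
  have h3 := norm_sub_inner_smul_sq hz ω
  have h4 : ‖ω - inner ℂ z ω • z‖ ≤ 1 := by
    rw [hω] at h3
    nlinarith [norm_nonneg (ω - inner ℂ z ω • z), sq_nonneg ‖inner ℂ z ω‖]
  rw [hz] at h2
  have h5 := mul_le_mul_of_nonneg_left h2 (norm_nonneg (inner ℂ z ω))
  have h6 := mul_le_mul_of_nonneg_left h4 hδ
  linarith

/-- Amplitudes are square roots of probabilities: 1/100 = √(1/10000) and 99/100 < √(1 - 1/10000). -/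
theorem UniquelySolves.exists_witness {V : OracleVerifier n L W} {k : ℕ} {ε : ℝ}
    (hV : V.UniquelySolves (reflectProblem k n) ε) (hε : ε ≤ 1 / 10000)
    {S : Submodule ℂ (Qubits n)} (h1 : 1 ≤ Module.finrank ℂ S)
    (h2 : Module.finrank ℂ S ≤ 2 ^ k) :
    ∃ ω : W, ‖ω‖ = 1 ∧ 99 / 100 ≤ V.acceptAmp (reflectOracle S) ω ∧
      V.RejectsOrthogonal (reflectOracle S) ω (1 / 100) := by
  obtain ⟨ω, hω, hacc, hrej⟩ := hV.1 (reflectOracle S)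
    ⟨S, h1, h2, isReflectionAbout_reflectOracle S⟩
  refine ⟨ω, hω, ?_, V.rejectsOrthogonal_of_acceptProb_le (by norm_num) fun ω' hω' ho =>
    (hrej ω' hω' ho).trans (by linarith)⟩
  rw [acceptProb_eq] at hacc
  by_contra! hlt
  nlinarith [V.acceptAmp_nonneg (reflectOracle S) ω]

theorem UniquelySolves.acceptAmp_bot_le {V : OracleVerifier n L W} {k : ℕ} {ε : ℝ}
    (hV : V.UniquelySolves (reflectProblem k n) ε) (hε : ε ≤ 1 / 10000) {ω : W}
    (hω : ‖ω‖ = 1) : V.acceptAmp (reflectOracle ⊥) ω ≤ 1 / 100 := by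
  have h := hV.2 _ rfl ω hω
  rw [← reflectOracle_bot, acceptProb_eq] at h
  by_contra! hlt
  nlinarith

/-- A verifier makes many queries if its queries on the witnesses of `|x⟩` and `|y⟩` touch
`|y⟩` and `|x⟩` with a large amplitude. -/
theorem UniquelySolves.lt_queryWeight {V : OracleVerifier n L W} {k : ℕ} {ε : ℝ}
    (hV : V.UniquelySolves (reflectProblem k n) ε) (hε : ε ≤ 1 / 10000) (hk : 1 ≤ k)
    {x y : Fin n → Fin 2} (hxy : x ≠ y) {ω ω' : W} (hω : ‖ω‖ = 1) (hω' : ‖ω'‖ = 1)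
    (hx : 99 / 100 ≤ V.acceptAmp (reflectOracle (ketLine x)) ω)
    (hy : 99 / 100 ≤ V.acceptAmp (reflectOracle (ketLine y)) ω')
    (hrej : V.RejectsOrthogonal (reflectOracle (ketLine y)) ω' (1 / 100))
    (hwx : V.queryWeight (reflectOracle (ketLine x)) ω y ≤ 1 / 100)
    (hwy : V.queryWeight (reflectOracle (ketLine y)) ω' x ≤ 1 / 100) :
    1 / 100 < V.queryWeight (reflectOracle ⊥) ω y := by
  by_contra! hw0
  have hdim : Module.finrank ℂ (ketLine x ⊔ ketLine y : Submodule ℂ (Qubits n)) ≤ 2 ^ k := by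
    have h1 := Submodule.finrank_add_le_finrank_add_finrank (ketLine x) (ketLine y)
    rw [finrank_ketLine, finrank_ketLine] at h1
    exact h1.trans (by simpa using Nat.pow_le_pow_right (n := 2) (by norm_num) hk)
  have hdim' : 1 ≤ Module.finrank ℂ (ketLine x ⊔ ketLine y : Submodule ℂ (Qubits n)) := by
    rw [← finrank_ketLine x]
    exact Submodule.finrank_mono le_sup_left
  obtain ⟨z, hz, -, hzrej⟩ := hV.exists_witness hε hdim' hdim
  have ax := abs_le.mp (V.abs_acceptAmp_sup_sub_le (ketLine_isOrtho hxy) ω)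
  have ay := abs_le.mp (V.abs_acceptAmp_sup_sub_le (ketLine_isOrtho hxy.symm) ω')
  rw [sup_comm] at ay
  have a0 := abs_le.mp (V.abs_acceptAmp_sup_sub_le (y := y) (Submodule.isOrtho_bot_left) ω)
  rw [bot_sup_eq] at a0
  have px := V.le_norm_inner_of_le_acceptAmp (by norm_num) hz hω hzrej
  have py := V.le_norm_inner_of_le_acceptAmp (by norm_num) hz hω' hzrej
  -- 96/100 = 99/100 - 2/100 - 1/100: the hybrid loss, then the error of the orthogonal part.
  have hin := two_mul_sq_sub_one_le_norm_inner hz hω' hω (p := 96 / 100) (by norm_num)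
    (by linarith) (by linarith)
  have hb := (V.acceptAmp_bounds hω' hrej ω).1
  have hr : ‖ω - inner ℂ ω' ω • ω'‖ ≤ 1 := by
    have h3 := norm_sub_inner_smul_sq hω' ω
    rw [hω] at h3
    nlinarith [norm_nonneg (ω - inner ℂ ω' ω • ω'), sq_nonneg ‖inner ℂ ω' ω‖]
  have hbot := hV.acceptAmp_bot_le hε hω
  -- The overlap is at least 2(96/100)² - 1 > 1/2. Yet `a0` and `hbot` bound the amplitude of `ω`
  -- under the reflection about |y⟩ by 3/100, which with the error 1/100 in `hb` is a contradiction.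
  have hmul : (1 / 2 : ℝ) * (99 / 100) ≤
      ‖inner ℂ ω' ω‖ * V.acceptAmp (reflectOracle (ketLine y)) ω' :=
    mul_le_mul (by linarith) hy (by norm_num) (norm_nonneg _)
  linarith

theorem UniquelySolves.mul_sqrt_two_pow_le {V : OracleVerifier n L W} {k : ℕ} {ε : ℝ}
    (hV : V.UniquelySolves (reflectProblem k n) ε) (hε : ε ≤ 1 / 10000) (hk : 1 ≤ k)
    (hn : 1 ≤ n) : 1 / 500 * Real.sqrt (2 ^ n) ≤ L := by
  have hwit (x : Fin n → Fin 2) := hV.exists_witness hε (finrank_ketLine x).ge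
    ((finrank_ketLine x).le.trans Nat.one_le_two_pow)
  choose ω hω hacc hrej using hwit
  let wt (x y : Fin n → Fin 2) : ℝ := V.queryWeight (reflectOracle (ketLine x)) (ω x) y
  let wt₀ (x y : Fin n → Fin 2) : ℝ := V.queryWeight (reflectOracle ⊥) (ω x) y
  have hcard : Fintype.card (Fin n → Fin 2) = 2 ^ n := by simp
  have sum1 : ∑ x, ∑ y, wt x y ^ 2 ≤ 2 ^ n * (L : ℝ) ^ 2 := by
    refine (Finset.sum_le_card_nsmul _ _ _ fun x _ => V.sum_queryWeight_sq_le
      (isReflectionAbout_reflectOracle _) (hω x)).trans_eq ?_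
    simp [hcard]
  have sum2 : ∑ x, ∑ y, wt₀ x y ^ 2 ≤ 2 ^ n * (L : ℝ) ^ 2 := by
    refine (Finset.sum_le_card_nsmul _ _ _ fun x _ => V.sum_queryWeight_sq_le
      (isReflectionAbout_reflectOracle _) (hω x)).trans_eq ?_
    simp [hcard]
  have hlarge : ∀ p ∈ (Finset.univ : Finset (Fin n → Fin 2)).offDiag,
      (1 / 10000 : ℝ) ≤ wt p.1 p.2 ^ 2 + wt p.2 p.1 ^ 2 + wt₀ p.1 p.2 ^ 2 := by
    rintro ⟨x, y⟩ hp
    have hxy : x ≠ y := (Finset.mem_offDiag.mp hp).2.2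
    by_contra! hlt
    have small {a b : ℝ} (hb : 0 ≤ b) (h : a + b ^ 2 < 1 / 10000) (ha : 0 ≤ a) : b ≤ 1 / 100 := by
      by_contra! hb'
      nlinarith
    simp only at hlt
    have h1 : wt x y ≤ 1 / 100 := small (a := wt y x ^ 2 + wt₀ x y ^ 2)
      (V.circuit.queryWeight_nonneg _ _ _) (by linarith) (by positivity)
    have h2 : wt y x ≤ 1 / 100 := small (a := wt x y ^ 2 + wt₀ x y ^ 2)
      (V.circuit.queryWeight_nonneg _ _ _) (by linarith) (by positivity)
    have h3 : wt₀ x y ≤ 1 / 100 := small (a := wt x y ^ 2 + wt y x ^ 2)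
      (V.circuit.queryWeight_nonneg _ _ _) (by linarith) (by positivity)
    exact (hV.lt_queryWeight hε hk hxy (hω x) (hω y) (hacc x) (hacc y) (hrej y) h1 h2).not_ge
      h3
  have hsum := Finset.card_nsmul_le_sum _ _ _ hlarge
  have hle : ∑ p ∈ (Finset.univ : Finset (Fin n → Fin 2)).offDiag,
      (wt p.1 p.2 ^ 2 + wt p.2 p.1 ^ 2 + wt₀ p.1 p.2 ^ 2) ≤ 3 * (2 ^ n * (L : ℝ) ^ 2) := by
    calc _ ≤ ∑ p : (Fin n → Fin 2) × (Fin n → Fin 2),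
          (wt p.1 p.2 ^ 2 + wt p.2 p.1 ^ 2 + wt₀ p.1 p.2 ^ 2) :=
        Finset.sum_le_sum_of_subset_of_nonneg (Finset.subset_univ _) fun _ _ _ => by positivity
      _ = ∑ x, ∑ y, wt x y ^ 2 + ∑ y, ∑ x, wt x y ^ 2 + ∑ x, ∑ y, wt₀ x y ^ 2 := by
        simp only [Fintype.sum_prod_type, Finset.sum_add_distrib]
      _ ≤ _ := by
        rw [Finset.sum_comm (s := Finset.univ) (t := Finset.univ) (f := fun y x => wt x y ^ 2)]
        linarith
  have hN : (2 : ℝ) ≤ 2 ^ n := by simpa using pow_le_pow_right₀ (one_le_two (α := ℝ)) hn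
  have hoff : ((Finset.univ : Finset (Fin n → Fin 2)).offDiag.card : ℝ) =
      2 ^ n * 2 ^ n - 2 ^ n := by
    rw [Finset.offDiag_card, Finset.card_univ, hcard, Nat.cast_sub (Nat.le_mul_self _)]
    push_cast
    ring
  rw [nsmul_eq_mul, hoff] at hsum
  -- With N = 2^n ≥ 2, the count N(N - 1)/10000 ≤ 3NL² gives N ≤ 60000 L², below 500² L².
  have hmain : (2 : ℝ) ^ n ≤ (500 * L) ^ 2 := by
    refine le_of_mul_le_mul_left (a := (2 : ℝ) ^ n) ?_ (by positivity)
    nlinarith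
  have hs := Real.sqrt_le_sqrt hmain
  rw [Real.sqrt_sq (by positivity)] at hs
  linarith

theorem UniquelySolves.one_le {V : OracleVerifier n L W} {k : ℕ} {ε : ℝ}
    (hV : V.UniquelySolves (reflectProblem k n) ε) (hε : ε ≤ 1 / 10000) : 1 ≤ L := by
  by_contra! hL
  obtain rfl : L = 0 := by omega
  have y : Fin n → Fin 2 := fun _ => 0
  obtain ⟨ω, hω, hacc, -⟩ := hV.exists_witness hε (finrank_ketLine y).ge
    ((finrank_ketLine y).le.trans Nat.one_le_two_pow)
  have h := hV.acceptAmp_bot_le hε hω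
  -- Without queries the final state does not involve the oracle.
  have h2 : V.acceptAmp (reflectOracle (ketLine y)) ω = V.acceptAmp (reflectOracle ⊥) ω := rfl
  linarith

theorem UniquelySolves.le_queries {V : OracleVerifier n L W} {k : ℕ} {ε : ℝ}
    (hV : V.UniquelySolves (reflectProblem k n) ε) (hε : ε ≤ 1 / 10000) (hk : k < n) :
    1 / 500 * Real.sqrt (2 ^ k) ≤ L := by
  rcases Nat.eq_zero_or_pos k with rfl | hk0
  · have h : (1 : ℝ) ≤ L := by exact_mod_cast hV.one_le hε
    norm_num
    linarith
  · refine le_trans ?_ (hV.mul_sqrt_two_pow_le hε hk0 (by omega))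
    gcongr
    norm_num

end OracleVerifier

/-! ### Asymptotics and the main theorem. -/

theorem ExponentiallySmall.eventually_le {ε : ℕ → ℝ} (h : ExponentiallySmall ε) {δ : ℝ}
    (hδ : 0 < δ) : ∀ᶠ n in atTop, ε n ≤ δ := by
  obtain ⟨a, ha, hO⟩ := h
  have hexp : Tendsto (fun n : ℕ => Real.exp (-a * n)) atTop (nhds 0) := by
    refine Real.tendsto_exp_atBot.comp ?_
    exact tendsto_natCast_atTop_atTop.const_mul_atTop_of_neg (by linarith)
  exact (hO.trans_tendsto hexp).eventually_le_const hδ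

/-- If `k n` grows at least linearly then `√(2 ^ k n)` grows exponentially. -/
theorem exists_pow_le_mul_sqrt_two_pow {k : ℕ → ℕ} {c : ℝ} (hc : 0 < c)
    (hk : (fun n : ℕ => (n : ℝ)) =O[atTop] fun n : ℕ => (k n : ℝ)) :
    ∃ b : ℝ, 1 < b ∧ ∀ᶠ n : ℕ in atTop, b ^ n ≤ c * Real.sqrt (2 ^ k n) := by
  obtain ⟨C, hC, hb⟩ := hk.exists_pos
  have hb1 : (1 : ℝ) < 2 ^ (1 / (4 * C)) := Real.one_lt_rpow (by norm_num) (by positivity)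
  -- The fourth power of b^n is 2^(n/C) ≤ 2^(k n), so b^(2n) ≤ √(2^(k n)); the spare factor b^n
  -- eventually absorbs `c`.
  refine ⟨2 ^ (1 / (4 * C)), hb1, ?_⟩
  filter_upwards [hb.bound, (tendsto_pow_atTop_atTop_of_one_lt hb1).eventually_ge_atTop c⁻¹]
    with n hn hcn
  set b : ℝ := 2 ^ (1 / (4 * C)) with hbdef
  simp only [Real.norm_natCast] at hn
  have h4 : (b ^ n * b ^ n) ^ 2 ≤ 2 ^ k n := by
    have e : (b ^ n * b ^ n) ^ 2 = (2 : ℝ) ^ ((n : ℝ) / C) := by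
      rw [← pow_add, ← pow_mul, hbdef, ← Real.rpow_natCast, ← Real.rpow_mul (by norm_num)]
      congr 1
      push_cast
      field_simp
      ring
    rw [e, ← Real.rpow_natCast 2 (k n)]
    refine Real.rpow_le_rpow_of_exponent_le (by norm_num) ?_
    rw [div_le_iff₀ hC]
    linarith
  have h5 : b ^ n * b ^ n ≤ Real.sqrt (2 ^ k n) := Real.le_sqrt_of_sq_le h4
  have h6 : 1 ≤ c * b ^ n := by
    rwa [inv_le_iff_one_le_mul₀' hc] at hcn
  have h7 : 0 < b ^ n := pow_pos (by linarith) n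
  nlinarith [mul_le_mul_of_nonneg_left h5 hc.le, mul_le_mul_of_nonneg_right h6 h7.le]

end

theorem mainTheorem1 :
    ∃ c : ℝ, 0 < c ∧ ∀ ε : ℕ → ℝ, ExponentiallySmall ε →
      (∀ᶠ n : ℕ in atTop, ∀ k : ℕ, k < n →
        ∀ (W : Type*) [NormedAddCommGroup W] [InnerProductSpace ℂ W] [CompleteSpace W]
          (L : ℕ) (V : OracleVerifier n L W),
          V.UniquelySolves (reflectProblem k n) (ε n) → c * Real.sqrt (2 ^ k) ≤ (L : ℝ)) ∧
      (∀ k : ℕ → ℕ, (∀ᶠ n in atTop, k n < n) →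
        ((fun n : ℕ => (n : ℝ)) =O[atTop] fun n : ℕ => (k n : ℝ)) →
        ∃ b : ℝ, 1 < b ∧ ∀ᶠ n : ℕ in atTop,
          ∀ (W : Type*) [NormedAddCommGroup W] [InnerProductSpace ℂ W] [CompleteSpace W]
            (L : ℕ) (V : OracleVerifier n L W),
            V.UniquelySolves (reflectProblem (k n) n) (ε n) → b ^ n ≤ (L : ℝ)) := by
  refine ⟨1 / 500, by norm_num, fun ε hε => ⟨?_, fun k hk hkn => ?_⟩⟩
  · filter_upwards [hε.eventually_le (δ := 1 / 10000) (by norm_num)] with n hn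
    intro k hk W _ _ _ L V hV
    exact hV.le_queries hn hk
  · obtain ⟨b, hb, hbn⟩ := exists_pow_le_mul_sqrt_two_pow (c := 1 / 500) (by norm_num) hkn
    refine ⟨b, hb, ?_⟩
    filter_upwards [hε.eventually_le (δ := 1 / 10000) (by norm_num), hk, hbn] with n hn hk hbn
    intro W _ _ _ L V hV
    exact hbn.trans (hV.le_queries hn hk)
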